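/- Let $\{|n\rangle\}_{n\in\mathbb N}$ be the Fock basis of the single-mode Hilbert space $\ell^2(\mathbb N,\mathbb C)$, with creation and annihilation operators $\hat a^\dagger|n\rangle=\sqrt{n+1}\,|n+1\rangle$, $\hat a|n\rangle=\sqrt n\,|n-1\rangle$ (and $\hat a|0\rangle=0$), and for $\alpha\in\mathbb C$ let $|\alpha\rangle=e^{-|\alpha|^2/2}\sum_{n\ge0}\frac{\alpha^n}{\sqrt{n!}}|n\rangle$ be the coherent state and $\hat D(\alpha)=e^{\alpha\hat a^\dagger-\alpha^*\hat a}$ the displacement operator. For a unit vector $|\psi\rangle$, the approximate coherent state rank $\kappa(\psi)\in\mathbb N\cup\{\infty\}$ is the smallest $k$ such that for every $\varepsilon>0$ there are $c_1,\dots,c_k,\alpha_1,\dots,\alpha_k\in\mathbb C$ for which $|\phi_\varepsilon\rangle=\sum_{j=1}^kc_j|\alpha_j\rangle$ is a unit vector with $|\langle\psi|\phi_\varepsilon\rangle|^2\ge1-\varepsilon$. A core state with highest Fock number $m$ is a unit vector $\sum_{i=0}^{m}x_i|i\rangle$ with $x_m\neq0$. Theorem. Let $|\psi\rangle=\sum_{n\ge0}\psi_n|n\rangle$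 be a single-mode pure state (unit vector) and let $r>0$ be an integer. The following are equivalent: (i) $\kappa(\psi)=r$; (ii) the sequence $s_n=\sqrt{n!}\,\psi_n$ follows a linear recurrence relation of order $r$: there are $a_0,\dots,a_{r-1}\in\mathbb C$ with $s_{n+r}=\sum_{i=0}^{r-1}a_is_{n+i}$ for all $n\ge0$, and no relation of this form holds with $r$ replaced by a smaller non-negative integer; (iii) $|\psi\rangle=\sum_{j=1}^kc_j\,\hat D(\alpha_j)|C_j\rangle$ for some $k$, non-zero $c_j\in\mathbb C$, pairwise distinct $\alpha_j\in\mathbb C$ and core states $|C_j\rangle$ with highest Fock numbers $n_j$ satisfying $\sum_{j=1}^k(n_j+1)=r$. -/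

import Mathlib

open scoped Nat ComplexConjugate

namespace Bosonic

noncomputable section

/-- The single-mode Hilbert space: square-summable families of Fock amplitudes. A vector `ψ`
has the amplitude `ψ n` on the Fock state `|n⟩`; a pure state is a vector of norm one. -/
abbrev FockSpace : Type := lp (fun _ : ℕ => ℂ) 2

/-- The Fock state `|n⟩`. -/
def fock (n : ℕ) : FockSpace := lp.single 2 n (1 : ℂ)

/-- The Fock amplitudes `e^{-|α|²/2} αⁿ / √(n!)` of the coherent state `|α⟩`. -/
def coherentAmplitude (α : ℂ) (n : ℕ) : ℂ :=
  Complex.exp (-((‖α‖ ^ 2 / 2 : ℝ) : ℂ)) * (α ^ n / ((√(n ! : ℝ) : ℝ) : ℂ))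

theorem memℓp_coherentAmplitude (α : ℂ) :
    Memℓp (E := fun _ : ℕ => ℂ) (coherentAmplitude α) 2 := by
  apply memℓp_gen
  have h := (Real.summable_pow_div_factorial (‖α‖ ^ 2)).mul_left
    (‖Complex.exp (-((‖α‖ ^ 2 / 2 : ℝ) : ℂ))‖ ^ 2)
  refine h.congr fun n => ?_
  have h2 : (2 : ENNReal).toReal = ((2 : ℕ) : ℝ) := by norm_num
  rw [h2, Real.rpow_natCast, coherentAmplitude, norm_mul, norm_div, norm_pow, Complex.norm_real,
    Real.norm_of_nonneg (Real.sqrt_nonneg _), mul_pow, div_pow, Real.sq_sqrt (by positivity),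
    ← pow_mul, ← pow_mul, mul_comm 2 n]

/-- The coherent state `|α⟩ = e^{-|α|²/2} ∑ₙ αⁿ / √(n!) |n⟩`. -/
def coherent (α : ℂ) : FockSpace := ⟨coherentAmplitude α, memℓp_coherentAmplitude α⟩

/-- The fidelity `|⟨ψ|χ⟩|²` of two pure states. -/
def fidelity (ψ χ : FockSpace) : ℝ := ‖inner ℂ ψ χ‖ ^ 2

/-- For every `ε > 0` some state that is a superposition of `k` coherent states has fidelity at
least `1 - ε` with `ψ`. -/
def ApproximableByCoherent (ψ : FockSpace) (k : ℕ) : Prop :=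
  ∀ ε : ℝ, 0 < ε → ∃ c α : Fin k → ℂ,
    ‖∑ j, c j • coherent (α j)‖ = 1 ∧ 1 - ε ≤ fidelity ψ (∑ j, c j • coherent (α j))

/-- The approximate coherent state rank `κ(ψ)`: the smallest `k` such that `ψ` is approximable
to arbitrary precision by superpositions of `k` coherent states (`⊤` if there is none). -/
def approxCoherentRank (ψ : FockSpace) : ℕ∞ :=
  ⨅ (k : ℕ) (_ : ApproximableByCoherent ψ k), (k : ℕ∞)

/-- The sequence `s` satisfies a homogeneous linear recurrence with constant coefficients
`s (n + d) = ∑ i < d, aᵢ s (n + i)`, for all `n`, of order `d = r` and of no smaller order. -/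
def FollowsRecurrenceOfOrder (s : ℕ → ℂ) (r : ℕ) : Prop :=
  IsLeast {d : ℕ | ∃ E : LinearRecurrence ℂ, E.order = d ∧ E.IsSolution s} r

/-- Finite linear combinations of Fock states, given by their finitely many amplitudes. -/
abbrev CoreVector : Type := ℕ →₀ ℂ

/-- A core vector as an element of the Hilbert space: `C ↦ ∑ₙ C n |n⟩`. -/
def toFock : CoreVector →ₗ[ℂ] FockSpace := Finsupp.linearCombination ℂ fock

/-- The creation operator `a†|n⟩ = √(n+1) |n+1⟩` on core vectors. -/
def creation : CoreVector →ₗ[ℂ] CoreVector :=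
  Finsupp.linearCombination ℂ fun n => Finsupp.single (n + 1) ((√(n + 1 : ℝ) : ℝ) : ℂ)

/-- The annihilation operator `a|n⟩ = √n |n-1⟩`, `a|0⟩ = 0`, on core vectors. -/
def annihilation : CoreVector →ₗ[ℂ] CoreVector :=
  Finsupp.linearCombination ℂ fun n => Finsupp.single (n - 1) ((√(n : ℝ) : ℝ) : ℂ)

/-- The generator `α a† - α* a` of the displacement operator. -/
def displacementGenerator (α : ℂ) : CoreVector →ₗ[ℂ] CoreVector :=
  α • creation - conj α • annihilation

/-- The displacement operator `D(α) = exp (α a† - α* a)` applied to a core vector `C`: the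
exponential series `∑ₘ (1/m!) (α a† - α* a)ᵐ C`. The series converges in norm by
`summable_displace`. -/
def displace (α : ℂ) (C : CoreVector) : FockSpace :=
  ∑' m : ℕ, ((m ! : ℂ)⁻¹) • toFock ((displacementGenerator α ^ m) C)

/-- `C` is a core state (a normalized finite superposition of Fock states) with highest Fock
number `n`. -/
def IsCoreState (C : CoreVector) (n : ℕ) : Prop :=
  ‖toFock C‖ = 1 ∧ C n ≠ 0 ∧ ∀ m, n < m → C m = 0

/-- `ψ = ∑_{j=1}^k c_j D(α_j)|C_j⟩` with non-zero coefficients, distinct displacement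
amplitudes, and core states `C_j` of highest Fock number `n_j`, where `∑ (n_j + 1) = r`. -/
def IsDisplacedCoreSuperposition (ψ : FockSpace) (r : ℕ) : Prop :=
  ∃ (k : ℕ) (c α : Fin k → ℂ) (C : Fin k → CoreVector) (n : Fin k → ℕ),
    (∀ j, c j ≠ 0) ∧ Function.Injective α ∧ (∀ j, IsCoreState (C j) (n j)) ∧
    ∑ j, (n j + 1) = r ∧ ψ = ∑ j, c j • displace (α j) (C j)

theorem displacementGenerator_single (α : ℂ) (n : ℕ) :
    displacementGenerator α (Finsupp.single n 1) =
      (α * ((√(n + 1 : ℝ) : ℝ) : ℂ)) • Finsupp.single (n + 1) (1 : ℂ) -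
      (conj α * ((√(n : ℝ) : ℝ) : ℂ)) • Finsupp.single (n - 1) (1 : ℂ) := by
  simp [displacementGenerator, creation, annihilation, Finsupp.linearCombination_single]

theorem norm_generator_pow_single (α : ℂ) (m : ℕ) : ∀ n : ℕ,
    ‖toFock ((displacementGenerator α ^ m) (Finsupp.single n 1))‖ ≤
      (2 * ‖α‖) ^ m * √((n + m)! / n ! : ℝ) := by
  induction m with
  | zero =>
    intro n
    have h : ‖fock n‖ = 1 := by
      rw [fock, lp.norm_single (by norm_num)]; simp
    have h2 : (n ! : ℝ) ≠ 0 := by positivity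
    simp [toFock, Finsupp.linearCombination_single, h, h2]
  | succ m ih =>
    intro n
    rw [pow_succ, Module.End.mul_apply, displacementGenerator_single, map_sub, map_sub, map_smul,
      map_smul, map_smul, map_smul]
    refine (norm_sub_le _ _).trans ?_
    rw [norm_smul, norm_smul, norm_mul, norm_mul, RCLike.norm_conj, Complex.norm_real,
      Complex.norm_real, Real.norm_of_nonneg (Real.sqrt_nonneg _),
      Real.norm_of_nonneg (Real.sqrt_nonneg _)]
    have key1 : √(n + 1 : ℝ) * √((n + 1 + m)! / (n + 1)! : ℝ) = √((n + (m + 1))! / n ! : ℝ) := by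
      rw [← Real.sqrt_mul (by positivity), show n + 1 + m = n + (m + 1) by ring,
        Nat.factorial_succ n]
      congr 1
      push_cast
      have h2 : (n ! : ℝ) ≠ 0 := by positivity
      have h3 : (n + 1 : ℝ) ≠ 0 := by positivity
      field_simp
    have key2 : √(n : ℝ) * √((n - 1 + m)! / (n - 1)! : ℝ) ≤ √((n + (m + 1))! / n ! : ℝ) := by
      rcases n with _ | n
      · simp
      · rw [← Real.sqrt_mul (by positivity)]
        apply Real.sqrt_le_sqrt
        have e : n + 1 + (m + 1) = (n + m) + 1 + 1 := by ring
        rw [e, Nat.add_sub_cancel, Nat.factorial_succ (n + m + 1), Nat.factorial_succ (n + m),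
          Nat.factorial_succ n]
        push_cast
        have h2 : (0 : ℝ) < n ! := by positivity
        have h3 : (0 : ℝ) < (n + 1 : ℝ) := by positivity
        have h4 : (0 : ℝ) < (n + m)! := by positivity
        rw [le_div_iff₀ (by positivity)]
        have : ((n : ℝ) + 1) * ((n + m)! / n !) * ((n + 1) * n !) =
            (n + 1) * (n + 1) * (n + m)! := by field_simp
        rw [this, ← mul_assoc]
        apply mul_le_mul_of_nonneg_right _ h4.le
        have hn : (0 : ℝ) ≤ n := by positivity
        have hm : (0 : ℝ) ≤ m := by positivity
        nlinarith [mul_nonneg hn hm]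
    calc ‖α‖ * √(n + 1 : ℝ) *
          ‖toFock ((displacementGenerator α ^ m) (Finsupp.single (n + 1) 1))‖ +
        ‖α‖ * √(n : ℝ) * ‖toFock ((displacementGenerator α ^ m) (Finsupp.single (n - 1) 1))‖
        ≤ ‖α‖ * √(n + 1 : ℝ) * ((2 * ‖α‖) ^ m * √((n + 1 + m)! / (n + 1)! : ℝ)) +
          ‖α‖ * √(n : ℝ) * ((2 * ‖α‖) ^ m * √((n - 1 + m)! / (n - 1)! : ℝ)) := by
          gcongr
          · exact ih _
          · exact ih _
      _ = ‖α‖ * (2 * ‖α‖) ^ m * (√(n + 1 : ℝ) * √((n + 1 + m)! / (n + 1)! : ℝ)) +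
          ‖α‖ * (2 * ‖α‖) ^ m * (√(n : ℝ) * √((n - 1 + m)! / (n - 1)! : ℝ)) := by ring
      _ ≤ ‖α‖ * (2 * ‖α‖) ^ m * √((n + (m + 1))! / n ! : ℝ) +
          ‖α‖ * (2 * ‖α‖) ^ m * √((n + (m + 1))! / n ! : ℝ) := by
          rw [key1]; gcongr
      _ = (2 * ‖α‖) ^ (m + 1) * √((n + (m + 1))! / n ! : ℝ) := by ring

/-- The exponential series of the displacement operator converges on every core vector. -/
theorem summable_displace (α : ℂ) (C : CoreVector) :
    Summable fun m : ℕ => ((m ! : ℂ)⁻¹) • toFock ((displacementGenerator α ^ m) C) := by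
  induction C using Finsupp.induction_linear with
  | zero => simp
  | add f g hf hg =>
    refine (hf.add hg).congr fun m => ?_
    rw [map_add, map_add, smul_add]
  | single n z =>
    have hz : Finsupp.single n z = z • Finsupp.single n (1 : ℂ) := by simp
    suffices h : Summable fun m : ℕ =>
        ((m ! : ℂ)⁻¹) • toFock ((displacementGenerator α ^ m) (Finsupp.single n 1)) by
      refine (h.const_smul z).congr fun m => ?_
      rw [hz, map_smul, map_smul, smul_comm]
    apply Summable.of_norm_bounded
      (g := fun m : ℕ => (2 * (2 * ‖α‖) ^ 2 * 2) ^ m / m ! + 2 ^ n * (1 / 2 : ℝ) ^ m)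
    · exact (Real.summable_pow_div_factorial _).add
        ((summable_geometric_of_lt_one (by norm_num) (by norm_num)).mul_left _)
    · intro m
      rw [norm_smul, norm_inv, Complex.norm_natCast]
      refine (mul_le_mul_of_nonneg_left (norm_generator_pow_single α m n)
        (by positivity)).trans ?_
      have hm : (0 : ℝ) < m ! := by positivity
      have hn : (0 : ℝ) < n ! := by positivity
      have hc : ((n + m)! / n ! : ℝ) = (n + m).choose n * m ! := by
        rw [div_eq_iff hn.ne']
        have := Nat.add_choose_mul_factorial_mul_factorial n m
        rw [← this, Nat.choose_symm_add]; push_cast; ring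
      have hch : ((n + m).choose n : ℝ) ≤ 2 ^ n * 2 ^ m := by
        rw [← pow_add]; exact_mod_cast Nat.choose_le_two_pow _ _
      set x : ℝ := (2 * ‖α‖) ^ m with hx
      have hxx : (2 * (2 * ‖α‖) ^ 2 * 2) ^ m = x ^ 2 * 4 ^ m := by
        rw [hx, ← pow_mul, mul_comm m 2, pow_mul, ← mul_pow]; ring
      have hx0 : 0 ≤ x := by positivity
      have hA : 0 ≤ x ^ 2 * 4 ^ m / m ! + 2 ^ n * (1 / 2 : ℝ) ^ m := by positivity
      rw [hxx]
      have hs : (m ! : ℝ)⁻¹ * (x * √((n + m)! / n ! : ℝ)) =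
          √(x ^ 2 * ((n + m).choose n) / m !) := by
        rw [eq_comm, Real.sqrt_eq_iff_mul_self_eq (by positivity) (by positivity)]
        rw [show ∀ a b c : ℝ, a * (b * c) * (a * (b * c)) = a ^ 2 * b ^ 2 * (c * c) by
          intros; ring, Real.mul_self_sqrt (by positivity), hc]
        field_simp
      rw [hs]
      apply Real.sqrt_le_iff.mpr ⟨hA, ?_⟩
      have e1 : x ^ 2 * ((n + m).choose n) / m ! ≤ x ^ 2 * (2 ^ n * 2 ^ m) / m ! := by gcongr
      have e2 : x ^ 2 * (2 ^ n * 2 ^ m) / m ! =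
          (x ^ 2 * 4 ^ m / m !) * (2 ^ n * (1 / 2 : ℝ) ^ m) := by
        have : (4 : ℝ) ^ m * (1 / 2) ^ m = 2 ^ m := by rw [← mul_pow]; norm_num
        rw [← this]; ring
      rw [e2] at e1
      refine e1.trans ?_
      have p : 0 ≤ x ^ 2 * 4 ^ m / m ! := by positivity
      have q : (0 : ℝ) ≤ 2 ^ n * (1 / 2 : ℝ) ^ m := by positivity
      nlinarith [mul_nonneg p q]

end

end Bosonic

/-!
The rescaled amplitudes `s n = √(n!) ψ n` turn coherent states into geometric sequences and the
annihilation operator into the left shift `S`, so that everything is a statement about polynomials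
in `S` annihilating `s`.

A superposition of `k` coherent states is annihilated by a polynomial of degree `k` with the
displacements as roots. The sequences annihilated by some non-zero polynomial of degree at most `k`
form a closed set, because the polynomial can be normalized to a compact sphere. Conversely, if a
polynomial with repeated roots annihilates `s`, separate its roots slightly and keep the first `k`
values: by the Vandermonde determinant this gives superpositions of `k` coherent states, and they
converge to the state. So the closure of the superpositions of `k` coherent states consists of the
states that satisfy a recurrence of order `k`.

If the annihilator of `s` is generated by `∏ (X - αⱼ) ^ (nⱼ + 1)`, primary decomposition writes `s`
as a sum of generalized eigenvectors of `S` with eigenvalues `αⱼ` and exact orders `nⱼ + 1`. Since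
`[a, α a† - α* a] = α`, the displacement `D(α)` intertwines `a` with `S - α`, and it sends the
kernel `ℂ|0⟩` of `a` onto that of `S - α`; hence these generalized eigenvectors are precisely the
displaced multiples of core states with highest Fock number `nⱼ`.
-/

namespace Bosonic

noncomputable section

open Polynomial Filter Topology

section Torsion

variable {R M ι : Type*} [CommRing R] [AddCommGroup M] [Module R M]

theorem smul_sum_eq_zero_iff_of_isCoprime [Fintype ι] {q : ι → R}
    (hq : Pairwise (Function.onFun IsCoprime q)) {x : ι → M} (hx : ∀ j, q j • x j = 0) (a : R) :
    a • ∑ j, x j = 0 ↔ ∀ j, a • x j = 0 := by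
  classical
  have hindep : iSupIndep fun j => Submodule.torsionBy R M (q j) :=
    iSupIndep_iff_supIndep_univ.2
      (Submodule.supIndep_torsionBy fun i _ j _ hij => hq hij)
  refine ⟨fun h j => ?_, fun h => by simp [Finset.smul_sum, h]⟩
  rw [Finset.smul_sum] at h
  refine (iSupIndep_iff_finsetSum_eq_zero_imp_eq_zero _).1 hindep Finset.univ
    (fun j => a • x j) (fun j _ => ?_) h j (Finset.mem_univ j)
  rw [Submodule.mem_torsionBy_iff, smul_comm, hx, smul_zero]

theorem exists_sum_eq_of_prod_smul_eq_zero [Fintype ι] {q : ι → R}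
    (hq : Pairwise (Function.onFun IsCoprime q)) {x : M} (hx : (∏ j, q j) • x = 0) :
    ∃ y : ι → M, x = ∑ j, y j ∧ ∀ j, q j • y j = 0 := by
  classical
  have hmem : x ∈ ⨆ j ∈ (Finset.univ : Finset ι), Submodule.torsionBy R M (q j) := by
    rwa [Submodule.iSup_torsionBy_eq_torsionBy_prod fun i _ j _ hij => hq hij]
  obtain ⟨y, rfl⟩ := (Submodule.mem_iSup_finset_iff_exists_sum _ x).1 hmem
  exact ⟨fun j => y j, rfl, fun j => (y j).2⟩

theorem smul_eq_zero_iff_prime_pow_dvd [IsDomain R] [IsPrincipalIdealRing R] {p : R}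
    (hp : Prime p) {n : ℕ} {x : M} (hx : p ^ (n + 1) • x = 0) (hx' : p ^ n • x ≠ 0) {a : R} :
    a • x = 0 ↔ p ^ (n + 1) ∣ a := by
  refine ⟨fun ha => ?_, fun ⟨b, hb⟩ => by rw [hb, mul_comm, mul_smul, hx, smul_zero]⟩
  obtain ⟨g, hg⟩ := IsPrincipalIdealRing.principal (Ideal.torsionOf R M x)
  have hmem (b : R) : b • x = 0 ↔ g ∣ b := by
    rw [← Ideal.mem_torsionOf_iff, hg]; exact Ideal.mem_span_singleton
  obtain ⟨i, -, hgi⟩ := (dvd_prime_pow hp _).1 ((hmem _).1 hx)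
  have hni : n < i := by
    by_contra! hin
    exact hx' ((hmem _).2 (hgi.dvd.trans (pow_dvd_pow p hin)))
  exact (pow_dvd_pow p hni).trans (hgi.symm.dvd.trans ((hmem a).1 ha))

theorem annihilator_eq_prod_prime_pow_iff [IsDomain R] [IsPrincipalIdealRing R] [Fintype ι]
    {p : ι → R} (hp : ∀ j, Prime (p j)) (hcop : Pairwise (Function.onFun IsCoprime p)) (n : ι → ℕ)
    {x : M} :
    (∀ a : R, a • x = 0 ↔ ∏ j, p j ^ (n j + 1) ∣ a) ↔
      ∃ y : ι → M, x = ∑ j, y j ∧ ∀ j, p j ^ (n j + 1) • y j = 0 ∧ p j ^ n j • y j ≠ 0 := by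
  classical
  have hq : Pairwise (Function.onFun IsCoprime fun j => p j ^ (n j + 1)) :=
    fun i j hij => (hcop hij).pow
  constructor
  · intro h
    obtain ⟨y, rfl, hy⟩ := exists_sum_eq_of_prod_smul_eq_zero hq ((h _).2 dvd_rfl)
    refine ⟨y, rfl, fun j => ⟨hy j, fun hj => (hp j).not_isUnit ?_⟩⟩
    set r := ∏ i ∈ Finset.univ.erase j, p i ^ (n i + 1) with hr
    have hprod : ∏ i, p i ^ (n i + 1) = r * p j ^ n j * p j := by
      rw [← Finset.prod_erase_mul _ _ (Finset.mem_univ j), pow_succ, mul_assoc]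
    have hkill : (r * p j ^ n j) • ∑ i, y i = 0 := by
      refine (smul_sum_eq_zero_iff_of_isCoprime hq hy _).2 fun i => ?_
      obtain rfl | hij := eq_or_ne i j
      · rw [mul_smul, hj, smul_zero]
      · rw [hr, ← Finset.prod_erase_mul _ _ (Finset.mem_erase.2 ⟨hij, Finset.mem_univ i⟩)]
        rw [mul_right_comm, mul_smul, hy, smul_zero]
    have hne : r * p j ^ n j ≠ 0 := mul_ne_zero
      (Finset.prod_ne_zero_iff.2 fun i _ => pow_ne_zero _ (hp i).ne_zero)
      (pow_ne_zero _ (hp j).ne_zero)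
    have hdvd : r * p j ^ n j * p j ∣ r * p j ^ n j * 1 := by
      rw [← hprod, mul_one]; exact (h _).1 hkill
    exact isUnit_of_dvd_one ((mul_dvd_mul_iff_left hne).1 hdvd)
  · rintro ⟨y, rfl, hy⟩ a
    simp only [smul_sum_eq_zero_iff_of_isCoprime hq (fun j => (hy j).1),
      smul_eq_zero_iff_prime_pow_dvd (hp _) (hy _).1 (hy _).2]
    exact ⟨Fintype.prod_dvd_of_coprime hq,
      fun h j => (Finset.dvd_prod_of_mem _ (Finset.mem_univ j)).trans h⟩

end Torsion

section Intertwining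

variable {R M N : Type*} [Ring R] [AddCommGroup M] [AddCommGroup N] [Module R M] [Module R N]
  {f : M →ₗ[R] N} {g : Module.End R M} {h : Module.End R N}

theorem pow_apply_of_intertwines (hfg : ∀ x, h (f x) = f (g x)) (m : ℕ) (x : M) :
    (h ^ m) (f x) = f ((g ^ m) x) := by
  simpa only [Module.End.coe_pow] using
    ((show Function.Semiconj f g h from fun x => (hfg x).symm).iterate_right m x).symm

theorem injective_of_intertwines (hfg : ∀ x, h (f x) = f (g x))
    (hnil : ∀ x, ∃ m, (g ^ m) x = 0) (hker : ∀ x, g x = 0 → f x = 0 → x = 0) :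
    Function.Injective f := by
  refine (injective_iff_map_eq_zero f).2 fun x hx => ?_
  obtain ⟨m, hm⟩ := hnil x
  induction m with
  | zero => exact hm
  | succ m ih =>
    refine ih (hker _ ?_ ?_)
    · rwa [← Module.End.mul_apply, ← pow_succ']
    · rw [← pow_apply_of_intertwines hfg, hx, map_zero]

theorem ker_pow_le_range_of_intertwines (hfg : ∀ x, h (f x) = f (g x))
    (hg : Function.Surjective g) (hker : LinearMap.ker h ≤ LinearMap.range f) (m : ℕ) :
    LinearMap.ker (h ^ m) ≤ LinearMap.range f := by
  induction m with
  | zero =>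
    rintro y (rfl : y = 0)
    exact zero_mem _
  | succ m ih =>
    intro y hy
    rw [LinearMap.mem_ker, pow_succ, Module.End.mul_apply] at hy
    obtain ⟨x, hx⟩ := ih hy
    obtain ⟨z, rfl⟩ := hg x
    have hz : y - f z ∈ LinearMap.range f := hker (by
      rw [LinearMap.mem_ker, map_sub, hfg, hx, sub_self])
    simpa only [sub_add_cancel] using add_mem hz (LinearMap.mem_range_self f z)

end Intertwining

section Commutator

variable {R A : Type*} [Ring R] [Ring A] [Module R A] [IsScalarTower R A A] [SMulCommClass R A A]

theorem mul_smul_sub_smul_of_mul_eq_mul_add_one {a b : A} (hab : a * b = b * a + 1) (c d : R) :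
    a * (c • b - d • a) = (c • b - d • a) * a + c • 1 := by
  rw [mul_sub, sub_mul, mul_smul_comm, mul_smul_comm, smul_mul_assoc, smul_mul_assoc, hab, smul_add]
  abel

theorem mul_pow_succ_of_mul_eq_mul_add_smul_one {a b : A} {c : R}
    (hab : a * b = b * a + c • 1) (m : ℕ) :
    a * b ^ (m + 1) = b ^ (m + 1) * a + ((m + 1 : ℕ) * c) • b ^ m := by
  induction m with
  | zero => simpa using hab
  | succ m ih =>
    calc a * b ^ (m + 2) = (b ^ (m + 1) * a + ((m + 1 : ℕ) * c) • b ^ m) * b := by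
          rw [pow_succ b (m + 1), ← mul_assoc, ih]
      _ = b ^ (m + 1) * (a * b) + ((m + 1 : ℕ) * c) • b ^ (m + 1) := by
          rw [add_mul, mul_assoc, smul_mul_assoc, ← pow_succ]
      _ = b ^ (m + 2) * a + (c + (m + 1 : ℕ) * c) • b ^ (m + 1) := by
          rw [hab, mul_add, mul_smul_comm, mul_one, ← mul_assoc, ← pow_succ, add_smul, add_assoc]
      _ = b ^ (m + 2) * a + ((m + 2 : ℕ) * c) • b ^ (m + 1) := by
          congr 2
          push_cast
          noncomm_ring

end Commutator

section Analysis

theorem biInf_natCast_eq_iff {s : Set ℕ} {r : ℕ} : ⨅ k ∈ s, (k : ℕ∞) = r ↔ IsLeast s r := by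
  obtain rfl | hs := s.eq_empty_or_nonempty
  · simp [IsLeast]
  · rw [← ENat.natCast_sInf hs, Nat.cast_inj]
    exact ⟨fun h => h ▸ ⟨Nat.sInf_mem hs, fun _ => Nat.sInf_le⟩, IsLeast.csInf_eq⟩

theorem norm_sub_inner_smul_sq {𝕜 E : Type*} [RCLike 𝕜] [NormedAddCommGroup E]
    [InnerProductSpace 𝕜 E] (x : E) {y : E} (hy : ‖y‖ = 1) :
    ‖x - inner 𝕜 y x • y‖ ^ 2 = ‖x‖ ^ 2 - ‖inner 𝕜 y x‖ ^ 2 := by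
  rw [@norm_sub_sq 𝕜, inner_smul_right, norm_smul, hy, ← inner_conj_symm x y, RCLike.mul_conj]
  norm_cast
  ring

theorem dense_setOf_injective {ι 𝕜 : Type*} [Finite ι] [NontriviallyNormedField 𝕜]
    [CompleteSpace 𝕜] : Dense {α : ι → 𝕜 | Function.Injective α} := by
  have := Fintype.ofFinite ι
  classical
  have hne (i j : ι) (hij : i ≠ j) :
      IsOpen {α : ι → 𝕜 | α i ≠ α j} ∧ Dense {α : ι → 𝕜 | α i ≠ α j} := by
    refine ⟨isOpen_ne_fun (continuous_apply i) (continuous_apply j), ?_⟩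
    let H := (LinearMap.proj i : (ι → 𝕜) →ₗ[𝕜] 𝕜).eqLocus (LinearMap.proj j)
    refine interior_eq_empty_iff_dense_compl.1 (Set.not_nonempty_iff_eq_empty.1 fun h => ?_)
    have hmem : Pi.single i 1 ∈ H := by
      rw [H.eq_top_of_nonempty_interior' h]; trivial
    simp [H, hij.symm] at hmem
  refine (dense_iInter_of_isOpen (fun q : {q : ι × ι // q.1 ≠ q.2} => (hne _ _ q.2).1)
    fun q => (hne _ _ q.2).2).mono fun α hα i j hij => ?_
  by_contra hij'
  exact Set.mem_iInter.1 hα ⟨(i, j), hij'⟩ hij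

theorem hasSum_div_factorial_of_recurrence {b : ℕ → ℂ} {c : ℂ} (h0 : b 0 = 1) (h1 : b 1 = 0)
    (hb : ∀ m, b (m + 2) = c * (m + 1) * b m) :
    HasSum (fun m => b m / m !) (Complex.exp (c / 2)) := by
  have heven (l : ℕ) : b (2 * l) / (2 * l)! = (c / 2) ^ l / l ! := by
    induction l with
    | zero => simp [h0]
    | succ l ih =>
      have hl : (l + 1 : ℂ) ≠ 0 := Nat.cast_add_one_ne_zero l
      have hl' : (2 * l + 1 : ℂ) ≠ 0 := mod_cast Nat.succ_ne_zero (2 * l)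
      calc b (2 * (l + 1)) / (2 * (l + 1))! = b (2 * l) / (2 * l)! * (c / 2 / (l + 1)) := by
            rw [mul_add_one, hb, Nat.factorial_succ, Nat.factorial_succ]
            push_cast
            rw [add_assoc, one_add_one_eq_two, ← mul_add_one]
            field_simp
        _ = (c / 2) ^ (l + 1) / (l + 1)! := by
            rw [ih, div_mul_div_comm, ← pow_succ, Nat.factorial_succ]
            push_cast
            ring
  have hodd (l : ℕ) : b (2 * l + 1) = 0 := by
    induction l with
    | zero => exact h1
    | succ l ih => rw [mul_add_one, add_right_comm, hb, ih, mul_zero]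
  rw [← add_zero (Complex.exp _), Complex.exp_eq_exp_ℂ]
  refine HasSum.even_add_odd ?_ ?_
  · simpa only [heven] using NormedSpace.expSeries_div_hasSum_exp (c / 2)
  · simpa only [hodd, zero_div] using hasSum_zero

end Analysis

section Recurrence

variable {R : Type*} [CommRing R]

/-- The left shift `(s₀, s₁, …) ↦ (s₁, s₂, …)`, through which polynomials act on sequences. -/
def shift (R : Type*) [CommRing R] : Module.End R (ℕ → R) := LinearMap.funLeft R R (· + 1)

theorem shift_apply (s : ℕ → R) (n : ℕ) : shift R s n = s (n + 1) := rfl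

theorem shift_pow_apply (s : ℕ → R) (i n : ℕ) : (shift R ^ i) s n = s (n + i) := by
  induction i generalizing s with
  | zero => rfl
  | succ i ih => rw [pow_succ, Module.End.mul_apply, ih, shift_apply, add_assoc]

theorem eq_of_shift_eq_smul {μ : R} {s t : ℕ → R} (hs : shift R s = μ • s) (ht : shift R t = μ • t)
    (h : s 0 = t 0) : s = t := by
  ext n
  induction n with
  | zero => exact h
  | succ n ih => rw [← shift_apply s, ← shift_apply t, hs, ht, Pi.smul_apply, Pi.smul_apply, ih]

theorem natDegree_charPoly [Nontrivial R] (E : LinearRecurrence R) :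
    E.charPoly.natDegree = E.order :=
  natDegree_eq_of_degree_eq_some E.charPoly_degree_eq_order

theorem isSolution_iff_aeval_charPoly (E : LinearRecurrence R) (s : ℕ → R) :
    E.IsSolution s ↔ aeval (shift R) E.charPoly s = 0 := by
  simp [LinearRecurrence.IsSolution, LinearRecurrence.charPoly, funext_iff, aeval_monomial,
    Algebra.algebraMap_eq_smul_one, shift_pow_apply, sub_eq_zero]

theorem charPoly_mk_neg_coeff {p : R[X]} (hp : p.Monic) {d : ℕ} (hd : p.natDegree = d) :
    (LinearRecurrence.mk d fun i => -p.coeff i).charPoly = p := by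
  conv_rhs => rw [hp.as_sum, hd, Finset.sum_range]
  simp [LinearRecurrence.charPoly, X_pow_eq_monomial]

/-- The sequence `s` satisfies some homogeneous linear recurrence with constant coefficients, of
order exactly `d`. -/
def SatisfiesRecurrence (s : ℕ → R) (d : ℕ) : Prop :=
  ∃ E : LinearRecurrence R, E.order = d ∧ E.IsSolution s

theorem satisfiesRecurrence_iff_exists_monic [Nontrivial R] {s : ℕ → R} {d : ℕ} :
    SatisfiesRecurrence s d ↔
      ∃ p : R[X], p.Monic ∧ p.natDegree = d ∧ aeval (shift R) p s = 0 := by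
  constructor
  · rintro ⟨E, rfl, hE⟩
    exact ⟨E.charPoly, E.charPoly_monic, natDegree_charPoly E,
      (isSolution_iff_aeval_charPoly E s).1 hE⟩
  · rintro ⟨p, hp, rfl, hs⟩
    exact ⟨_, rfl, (isSolution_iff_aeval_charPoly _ s).2 ((charPoly_mk_neg_coeff hp rfl).symm ▸ hs)⟩

variable {K : Type*} [Field K]

theorem satisfiesRecurrence_iff_exists_ne_zero {s : ℕ → K} {d : ℕ} :
    SatisfiesRecurrence s d ↔
      ∃ p : K[X], p ≠ 0 ∧ p.natDegree ≤ d ∧ aeval (shift K) p s = 0 := by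
  rw [satisfiesRecurrence_iff_exists_monic]
  refine ⟨fun ⟨p, hp, hd, hs⟩ => ⟨p, hp.ne_zero, hd.le, hs⟩, fun ⟨p, hp, hd, hs⟩ => ?_⟩
  have hm := monic_mul_leadingCoeff_inv hp
  refine ⟨X ^ (d - p.natDegree) * (p * C p.leadingCoeff⁻¹), (monic_X_pow _).mul hm, ?_, ?_⟩
  · rw [(monic_X_pow _).natDegree_mul hm, natDegree_X_pow, natDegree_mul_leadingCoeff_inv p hp]
    omega
  · rw [mul_comm p, ← mul_assoc, map_mul, Module.End.mul_apply, hs, map_zero]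

theorem isLeast_satisfiesRecurrence_iff {s : ℕ → K} {r : ℕ} :
    IsLeast {d | SatisfiesRecurrence s d} r ↔
      ∃ p : K[X], p.Monic ∧ p.natDegree = r ∧ ∀ q, aeval (shift K) q s = 0 ↔ p ∣ q := by
  constructor
  · rintro ⟨hr, hmin⟩
    obtain ⟨p, hp, rfl, hs⟩ := satisfiesRecurrence_iff_exists_monic.1 hr
    refine ⟨p, hp, rfl, fun q => ⟨fun hq => ?_, ?_⟩⟩
    · rw [← modByMonic_eq_zero_iff_dvd hp]
      by_contra hne
      have hrem : aeval (shift K) (q %ₘ p) s = 0 := by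
        rw [modByMonic_eq_sub_mul_div, mul_comm p, map_sub, map_mul, LinearMap.sub_apply,
          Module.End.mul_apply, hs, hq, map_zero, sub_zero]
      have hle := hmin (satisfiesRecurrence_iff_exists_ne_zero.2 ⟨_, hne, le_rfl, hrem⟩)
      exact (natDegree_modByMonic_lt q hp (by rintro rfl; simp at hne)).not_ge hle
    · rintro ⟨a, rfl⟩
      rw [mul_comm, map_mul, Module.End.mul_apply, hs, map_zero]
  · rintro ⟨p, hp, rfl, hgen⟩
    refine ⟨satisfiesRecurrence_iff_exists_monic.2 ⟨p, hp, rfl, (hgen p).2 dvd_rfl⟩, ?_⟩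
    rintro d hd
    obtain ⟨q, hq, hqd, hs⟩ := satisfiesRecurrence_iff_exists_ne_zero.1 hd
    exact (natDegree_le_of_dvd ((hgen q).1 hs) hq).trans hqd

end Recurrence

section RecurrenceTopology

theorem continuous_mkSol {R : Type*} [CommRing R] [TopologicalSpace R] [IsTopologicalRing R]
    (k : ℕ) :
    Continuous fun x : (Fin k → R) × (Fin k → R) => (LinearRecurrence.mk k x.1).mkSol x.2 := by
  refine continuous_pi fun n => ?_
  induction n using Nat.strong_induction_on with
  | _ n ih =>
    obtain hn | hn := lt_or_ge n k
    · exact ((continuous_apply (⟨n, hn⟩ : Fin k)).comp continuous_snd).congr fun x =>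
        ((LinearRecurrence.mk k x.1).mkSol_eq_init x.2 ⟨n, hn⟩).symm
    · obtain ⟨m, rfl⟩ := Nat.exists_eq_add_of_le' hn
      refine Continuous.congr ?_ fun x => ((LinearRecurrence.mk k x.1).is_sol_mkSol x.2 m).symm
      have hterm (i : Fin k) := ((continuous_apply i).comp continuous_fst).mul
        (ih _ (Nat.add_lt_add_left i.2 m))
      exact continuous_finsetSum Finset.univ fun i _ => hterm i

theorem norm_mkSol_le {𝕜 : Type*} [NormedCommRing 𝕜] {k : ℕ} {a : Fin k → 𝕜} {M : ℝ}
    (hM : 1 ≤ M) (ha : ∑ i, ‖a i‖ ≤ M) (init : Fin k → 𝕜) (n : ℕ) :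
    ‖(LinearRecurrence.mk k a).mkSol init n‖ ≤ ‖init‖ * M ^ n := by
  induction n using Nat.strong_induction_on with
  | _ n ih =>
    obtain hn | hn := lt_or_ge n k
    · refine le_trans ?_ (le_mul_of_one_le_right (norm_nonneg init) (one_le_pow₀ hM))
      exact ((LinearRecurrence.mk k a).mkSol_eq_init init ⟨n, hn⟩).symm ▸ norm_le_pi_norm init _
    · obtain ⟨m, rfl⟩ := Nat.exists_eq_add_of_le' hn
      rw [(LinearRecurrence.mk k a).is_sol_mkSol init m]
      obtain _ | k := k
      · simpa using by positivity
      calc ‖∑ i, a i * (LinearRecurrence.mk (k + 1) a).mkSol init (m + i)‖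
          ≤ ∑ i, ‖a i‖ * (‖init‖ * M ^ (m + k)) := by
            refine norm_sum_le_of_le _ fun i _ => (norm_mul_le _ _).trans ?_
            gcongr
            refine (ih _ (Nat.add_lt_add_left i.2 m)).trans ?_
            gcongr
            exact i.is_le
        _ = (∑ i, ‖a i‖) * (‖init‖ * M ^ (m + k)) := by rw [Finset.sum_mul]
        _ ≤ M * (‖init‖ * M ^ (m + k)) := by gcongr
        _ = ‖init‖ * M ^ (m + (k + 1)) := by ring

theorem exists_eventually_norm_mkSol_le {𝕜 : Type*} [NormedCommRing 𝕜] {k : ℕ} (a : Fin k → 𝕜) :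
    ∃ M : ℝ, ∀ᶠ b in 𝓝 a, ∀ init n, ‖(LinearRecurrence.mk k b).mkSol init n‖ ≤ ‖init‖ * M ^ n := by
  have hcont : Continuous fun b : Fin k → 𝕜 => ∑ i, ‖b i‖ := by fun_prop
  refine ⟨1 + ∑ i, ‖a i‖, ?_⟩
  filter_upwards [hcont.continuousAt.eventually (gt_mem_nhds (lt_one_add _))] with b hb
  exact norm_mkSol_le (le_add_of_nonneg_right (Finset.sum_nonneg fun _ _ => norm_nonneg _)) hb.le

theorem satisfiesRecurrence_iff_exists_norm_eq_one {𝕜 : Type*} [RCLike 𝕜] {s : ℕ → 𝕜} {d : ℕ} :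
    SatisfiesRecurrence s d ↔
      ∃ u : Fin (d + 1) → 𝕜, ‖u‖ = 1 ∧ ∀ n, ∑ i, u i * s (n + i) = 0 := by
  classical
  have haeval (u : Fin (d + 1) → 𝕜) (n : ℕ) :
      aeval (shift 𝕜) (ofFn (d + 1) u) s n = ∑ i, u i * s (n + i) := by
    simp [ofFn_eq_sum_monomial, aeval_monomial, Algebra.algebraMap_eq_smul_one, shift_pow_apply]
  rw [satisfiesRecurrence_iff_exists_ne_zero]
  constructor
  · rintro ⟨p, hp, hd, hs⟩
    obtain ⟨v, rfl⟩ : ∃ v, ofFn (d + 1) v = p :=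
      ⟨_, ofFn_comp_toFn_eq_id_of_natDegree_lt (Nat.lt_succ_of_le hd)⟩
    have hv : v ≠ 0 := by rintro rfl; simp at hp
    refine ⟨(‖v‖⁻¹ : 𝕜) • v, norm_smul_inv_norm hv, fun n => ?_⟩
    simp only [Pi.smul_apply, smul_eq_mul, mul_assoc, ← Finset.mul_sum, ← haeval, hs,
      Pi.zero_apply, mul_zero]
  · rintro ⟨u, hu, hs⟩
    have hu0 : u ≠ 0 := norm_ne_zero_iff.1 (hu ▸ one_ne_zero)
    exact ⟨ofFn (d + 1) u, (map_ne_zero_iff _ (injective_ofFn _)).2 hu0,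
      Nat.le_of_lt_succ (ofFn_natDegree_lt (Nat.le_add_left 1 d) u),
      funext fun n => (haeval u n).trans (hs n)⟩

-- The coefficient vectors range over a compact sphere, so the closed incidence relation between
-- coefficients and sequences has a closed projection.
theorem isClosed_setOf_satisfiesRecurrence {𝕜 : Type*} [RCLike 𝕜] (d : ℕ) :
    IsClosed {s : ℕ → 𝕜 | SatisfiesRecurrence s d} := by
  let Z : Set (Metric.sphere (0 : Fin (d + 1) → 𝕜) 1 × (ℕ → 𝕜)) :=
    ⋂ n, {x | ∑ i, x.1.1 i * x.2 (n + i) = 0}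
  have hcont (n : ℕ) : Continuous
      fun x : Metric.sphere (0 : Fin (d + 1) → 𝕜) 1 × (ℕ → 𝕜) => ∑ i, x.1.1 i * x.2 (n + i) :=
    continuous_finsetSum _ fun i _ =>
      ((continuous_apply i).comp (continuous_subtype_val.comp continuous_fst)).mul
        ((continuous_apply (n + (i : ℕ))).comp continuous_snd)
  have hZ : IsClosed Z := isClosed_iInter fun n => isClosed_eq (hcont n) continuous_const
  convert isClosedMap_snd_of_compactSpace _ hZ using 1
  ext s
  simp [Z, satisfiesRecurrence_iff_exists_norm_eq_one]

end RecurrenceTopology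

section Roots

variable {R : Type*} [CommRing R]

/-- The vector `a` for which `s (n + k) = ∑ aᵢ s (n + i)` is the recurrence with characteristic
polynomial `∏ (X - αⱼ)`. -/
def coeffsOfRoots {k : ℕ} (α : Fin k → R) : Fin k → R :=
  fun i => -(∏ j, (X - C (α j))).coeff i

/-- The recurrence of order `k` whose characteristic roots, with multiplicity, are the `αⱼ`. -/
def recurrenceOfRoots {k : ℕ} (α : Fin k → R) : LinearRecurrence R := ⟨k, coeffsOfRoots α⟩

theorem charPoly_recurrenceOfRoots [Nontrivial R] {k : ℕ} (α : Fin k → R) :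
    (recurrenceOfRoots α).charPoly = ∏ j, (X - C (α j)) :=
  charPoly_mk_neg_coeff (monic_prod_X_sub_C α Finset.univ) (by simp)

theorem continuous_coeff_prod_X_sub_C [TopologicalSpace R] [IsTopologicalRing R] {ι : Type*}
    (S : Finset ι) (i : ℕ) : Continuous fun α : ι → R => (∏ j ∈ S, (X - C (α j))).coeff i := by
  classical
  induction S using Finset.induction_on generalizing i with
  | empty => simpa using continuous_const
  | insert j S hj ih =>
    simp only [Finset.prod_insert hj, sub_mul, coeff_sub, coeff_C_mul]
    refine Continuous.sub ?_ ((continuous_apply j).mul (ih i))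
    cases i with
    | zero => simpa using continuous_const
    | succ i => simpa [coeff_X_mul] using ih i

theorem continuous_coeffsOfRoots [TopologicalSpace R] [IsTopologicalRing R] (k : ℕ) :
    Continuous (coeffsOfRoots : (Fin k → R) → Fin k → R) :=
  continuous_pi fun i => (continuous_coeff_prod_X_sub_C Finset.univ (i : ℕ)).neg

theorem exists_eq_prod_X_sub_C {K : Type*} [Field K] [IsAlgClosed K] {p : K[X]} (hp : p.Monic) :
    ∃ α : Fin p.natDegree → K, p = ∏ j, (X - C (α j)) := by
  have hsplit : p.Splits := IsAlgClosed.splits p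
  have hcard : p.roots.toList.length = p.natDegree := by
    rw [Multiset.length_toList, hsplit.natDegree_eq_card_roots]
  rw [← hcard]
  refine ⟨p.roots.toList.get, ?_⟩
  conv_lhs => rw [hsplit.eq_prod_roots_of_monic hp, ← Multiset.coe_toList p.roots]
  rw [Multiset.map_coe, Multiset.prod_coe, ← List.prod_ofFn]
  congr 1
  apply List.ext_get <;> simp

theorem exists_eq_prod_X_sub_C_pow {K : Type*} [Field K] [IsAlgClosed K] {p : K[X]}
    (hp : p.Monic) : ∃ (k : ℕ) (α : Fin k → K) (n : Fin k → ℕ), Function.Injective α ∧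
      p = ∏ j, (X - C (α j)) ^ (n j + 1) := by
  classical
  let e := p.roots.toFinset.equivFin.symm
  refine ⟨_, fun j => e j, fun j => p.rootMultiplicity (e j : K) - 1,
    Subtype.val_injective.comp e.injective, ?_⟩
  have hmult (j) : p.rootMultiplicity (e j : K) - 1 + 1 = p.rootMultiplicity (e j : K) :=
    Nat.sub_add_cancel ((rootMultiplicity_pos hp.ne_zero).2
      (isRoot_of_mem_roots (Multiset.mem_toFinset.1 (e j).2)))
  simp only [hmult]
  conv_lhs => rw [(IsAlgClosed.splits p).eq_prod_roots_of_monic hp,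
    Finset.prod_multiset_map_count]
  rw [← Finset.prod_coe_sort, ← e.prod_comp]
  simp [count_roots]

theorem forall_aeval_shift_eq_zero_iff_prod_dvd_iff {K ι : Type*} [Field K] [Fintype ι] {α : ι → K}
    (hα : Function.Injective α) (n : ι → ℕ) {s : ℕ → K} :
    (∀ q, aeval (shift K) q s = 0 ↔ ∏ j, (X - C (α j)) ^ (n j + 1) ∣ q) ↔
      ∃ y : ι → ℕ → K, s = ∑ j, y j ∧ ∀ j,
        aeval (shift K) ((X - C (α j)) ^ (n j + 1)) (y j) = 0 ∧
          aeval (shift K) ((X - C (α j)) ^ n j) (y j) ≠ 0 :=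
  letI := Module.compHom (ℕ → K) (aeval (R := K) (shift K)).toRingHom
  annihilator_eq_prod_prime_pow_iff (fun j => prime_X_sub_C (α j)) (pairwise_coprime_X_sub_C hα) n

theorem isLeast_satisfiesRecurrence_iff_exists_sum {K : Type*} [Field K] [IsAlgClosed K]
    {s : ℕ → K} {r : ℕ} :
    IsLeast {d | SatisfiesRecurrence s d} r ↔
      ∃ (k : ℕ) (α : Fin k → K) (n : Fin k → ℕ), Function.Injective α ∧ ∑ j, (n j + 1) = r ∧
        ∃ y : Fin k → ℕ → K, s = ∑ j, y j ∧ ∀ j,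
          aeval (shift K) ((X - C (α j)) ^ (n j + 1)) (y j) = 0 ∧
            aeval (shift K) ((X - C (α j)) ^ n j) (y j) ≠ 0 := by
  have hdeg {k : ℕ} (α : Fin k → K) (n : Fin k → ℕ) :
      (∏ j, (X - C (α j)) ^ (n j + 1)).natDegree = ∑ j, (n j + 1) := by
    simp [natDegree_prod_of_monic _ _ fun j _ => (monic_X_sub_C (α j)).pow (n j + 1)]
  rw [isLeast_satisfiesRecurrence_iff]
  constructor
  · rintro ⟨p, hp, hr, hq⟩
    obtain ⟨k, α, n, hα, rfl⟩ := exists_eq_prod_X_sub_C_pow hp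
    exact ⟨k, α, n, hα, hdeg α n ▸ hr, (forall_aeval_shift_eq_zero_iff_prod_dvd_iff hα n).1 hq⟩
  · rintro ⟨k, α, n, hα, hr, hy⟩
    exact ⟨_, monic_prod_of_monic _ _ fun j _ => (monic_X_sub_C _).pow _, (hdeg α n).trans hr,
      (forall_aeval_shift_eq_zero_iff_prod_dvd_iff hα n).2 hy⟩

theorem exists_geometric_sum_eq {K : Type*} [Field K] {k : ℕ} {α : Fin k → K}
    (hα : Function.Injective α) (s : Fin k → K) :
    ∃ c : Fin k → K, ∀ i : Fin k, ∑ j, c j * α j ^ (i : ℕ) = s i := by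
  have hunit : IsUnit (Matrix.vandermonde α) := (Matrix.isUnit_iff_isUnit_det _).2
    (isUnit_iff_ne_zero.2 (Matrix.det_vandermonde_ne_zero_iff.2 hα))
  obtain ⟨c, hc⟩ := Matrix.vecMul_surjective_iff_isUnit.2 hunit s
  exact ⟨c, fun i => by
    simpa [Matrix.vecMul, dotProduct, Matrix.vandermonde_apply] using congrFun hc i⟩

end Roots

section RescaledAmplitude

/-- The sequence `√(n!) ψₙ` of a state, as a continuous map into the product topology. -/
def rescaledAmplitude : FockSpace →L[ℂ] (ℕ → ℂ) :=
  ContinuousLinearMap.pi fun n => ((√(n ! : ℝ) : ℝ) : ℂ) • lp.evalCLM ℂ (fun _ : ℕ => ℂ) 2 n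

theorem rescaledAmplitude_apply (ψ : FockSpace) (n : ℕ) :
    rescaledAmplitude ψ n = ((√(n ! : ℝ) : ℝ) : ℂ) * ψ n := rfl

theorem sqrt_factorial_ne_zero (n : ℕ) : ((√(n ! : ℝ) : ℝ) : ℂ) ≠ 0 := by
  exact_mod_cast (Real.sqrt_pos.2 (Nat.cast_pos.2 n.factorial_pos)).ne'

theorem rescaledAmplitude_injective : Function.Injective rescaledAmplitude := fun _ _ h =>
  lp.ext (funext fun n => mul_left_cancel₀ (sqrt_factorial_ne_zero n) (congrFun h n))

theorem rescaledAmplitude_coherent (α : ℂ) (n : ℕ) :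
    rescaledAmplitude (coherent α) n = Complex.exp (-((‖α‖ ^ 2 / 2 : ℝ) : ℂ)) * α ^ n := by
  have hn := sqrt_factorial_ne_zero n
  change _ * coherentAmplitude α n = _
  rw [coherentAmplitude]
  field_simp

theorem norm_sq_eq_tsum_rescaledAmplitude (χ : FockSpace) :
    ‖χ‖ ^ 2 = ∑' n, ‖rescaledAmplitude χ n‖ ^ 2 / n ! := by
  have h := lp.norm_rpow_eq_tsum (p := 2) (by norm_num) χ
  simp only [ENNReal.toReal_ofNat, Real.rpow_ofNat] at h
  rw [h]
  refine tsum_congr fun n => ?_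
  have hn : (0 : ℝ) < n ! := by positivity
  rw [rescaledAmplitude_apply, norm_mul, Complex.norm_real,
    Real.norm_of_nonneg (Real.sqrt_nonneg _), mul_pow, Real.sq_sqrt hn.le]
  field_simp

-- Dominated convergence: a geometric bound is square-summable against the weights `1 / n!`.
theorem tendsto_of_rescaledAmplitude {β : Type*} {l : Filter β} {χ : β → FockSpace}
    {ψ : FockSpace} {B M : ℝ} (hχ : ∀ᶠ x in l, ∀ n, ‖rescaledAmplitude (χ x - ψ) n‖ ≤ B * M ^ n)
    (h : Tendsto (fun x => rescaledAmplitude (χ x)) l (𝓝 (rescaledAmplitude ψ))) :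
    Tendsto χ l (𝓝 ψ) := by
  rw [tendsto_iff_norm_sub_tendsto_zero]
  suffices hsq : Tendsto (fun x => ‖χ x - ψ‖ ^ 2) l (𝓝 0) by
    simpa [Real.sqrt_sq (norm_nonneg _)] using hsq.sqrt
  simp only [norm_sq_eq_tsum_rescaledAmplitude]
  rw [← tsum_zero (β := ℕ)]
  refine tendsto_tsum_of_dominated_convergence (bound := fun n => B ^ 2 * ((M ^ 2) ^ n / n !))
    ((Real.summable_pow_div_factorial _).mul_left _) (fun n => ?_) ?_
  · have hn : Tendsto (fun x => rescaledAmplitude (χ x - ψ) n) l (𝓝 0) := by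
      simpa using (tendsto_pi_nhds.1 h n).sub_const (rescaledAmplitude ψ n)
    simpa using (hn.norm.pow 2).div_const (n ! : ℝ)
  · filter_upwards [hχ] with x hx n
    rw [Real.norm_of_nonneg (by positivity), ← mul_div_assoc]
    gcongr
    calc ‖rescaledAmplitude (χ x - ψ) n‖ ^ 2 ≤ (B * M ^ n) ^ 2 := by gcongr; exact hx n
      _ = B ^ 2 * (M ^ 2) ^ n := by ring

end RescaledAmplitude

section Superpositions

/-- The superpositions of `k` coherent states, not necessarily normalized. -/
def coherentSuperpositions (k : ℕ) : Set FockSpace :=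
  {χ | ∃ c α : Fin k → ℂ, χ = ∑ j, c j • coherent (α j)}

theorem smul_mem_coherentSuperpositions {k : ℕ} {χ : FockSpace}
    (hχ : χ ∈ coherentSuperpositions k) (z : ℂ) : z • χ ∈ coherentSuperpositions k := by
  obtain ⟨c, α, rfl⟩ := hχ
  exact ⟨fun j => z * c j, α, by simp only [Finset.smul_sum, mul_smul]⟩

theorem approximableByCoherent_iff_mem_closure {ψ : FockSpace} (hψ : ‖ψ‖ = 1) {k : ℕ} :
    ApproximableByCoherent ψ k ↔ ψ ∈ closure (coherentSuperpositions k) := by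
  constructor
  · intro h
    refine Metric.mem_closure_iff.2 fun δ hδ => ?_
    obtain ⟨c, α, hnorm, hfid⟩ := h ((δ / 2) ^ 2) (by positivity)
    set χ := ∑ j, c j • coherent (α j)
    refine ⟨inner ℂ χ ψ • χ, smul_mem_coherentSuperpositions ⟨c, α, rfl⟩ _, ?_⟩
    have hdist : ‖ψ - inner ℂ χ ψ • χ‖ ^ 2 ≤ (δ / 2) ^ 2 := by
      rw [norm_sub_inner_smul_sq ψ hnorm, hψ, norm_inner_symm]
      linarith [show fidelity ψ χ = ‖inner ℂ ψ χ‖ ^ 2 from rfl]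
    rw [dist_eq_norm]
    linarith [(pow_le_pow_iff_left₀ (norm_nonneg _) (by positivity) two_ne_zero).1 hdist]
  · intro h ε hε
    have hψ0 : ‖ψ‖ ≠ 0 := hψ ▸ one_ne_zero
    have hcont : ContinuousAt (fun χ : FockSpace => fidelity ψ ((‖χ‖⁻¹ : ℂ) • χ)) ψ := by
      unfold fidelity
      fun_prop (disch := simpa using hψ0)
    have hlim : fidelity ψ ((‖ψ‖⁻¹ : ℂ) • ψ) = 1 := by
      simp [fidelity, hψ, inner_self_eq_norm_sq_to_K]
    obtain ⟨χ, hχ, hfid, hχ0⟩ := ((mem_closure_iff_frequently.1 h).and_eventually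
      ((hcont.eventually (lt_mem_nhds (hlim ▸ sub_lt_self 1 hε))).and
        (continuous_norm.continuousAt.eventually_ne hψ0))).exists
    obtain ⟨c, α, hsum⟩ := smul_mem_coherentSuperpositions hχ (‖χ‖⁻¹ : ℂ)
    refine ⟨c, α, ?_, ?_⟩
    · rw [← hsum]; exact norm_smul_inv_norm (norm_ne_zero_iff.1 hχ0)
    · rw [← hsum]; exact hlim ▸ hfid.le

theorem shift_rescaledAmplitude_coherent (α : ℂ) :
    shift ℂ (rescaledAmplitude (coherent α)) = α • rescaledAmplitude (coherent α) := by
  ext n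
  rw [shift_apply, Pi.smul_apply, smul_eq_mul, rescaledAmplitude_coherent,
    rescaledAmplitude_coherent]
  ring

theorem isSolution_recurrenceOfRoots {k : ℕ} (c α : Fin k → ℂ) :
    (recurrenceOfRoots α).IsSolution (rescaledAmplitude (∑ j, c j • coherent (α j))) := by
  rw [isSolution_iff_aeval_charPoly, charPoly_recurrenceOfRoots]
  simp only [map_sum, map_smul]
  refine Finset.sum_eq_zero fun j hj => ?_
  rw [← Finset.prod_erase_mul _ _ hj, map_mul, Module.End.mul_apply]
  simp [shift_rescaledAmplitude_coherent, Algebra.algebraMap_eq_smul_one]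

theorem exists_rescaledAmplitude_eq_mkSol {k : ℕ} {α : Fin k → ℂ} (hα : Function.Injective α)
    (init : Fin k → ℂ) : ∃ χ ∈ coherentSuperpositions k,
      rescaledAmplitude χ = (recurrenceOfRoots α).mkSol init := by
  obtain ⟨c, hc⟩ := exists_geometric_sum_eq hα init
  let z : Fin k → ℂ := fun j => Complex.exp (-((‖α j‖ ^ 2 / 2 : ℝ) : ℂ))
  refine ⟨∑ j, (c j * (z j)⁻¹) • coherent (α j), ⟨_, α, rfl⟩, ?_⟩
  refine (recurrenceOfRoots α).eq_mk_of_is_sol_of_eq_init' (isSolution_recurrenceOfRoots _ _)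
    fun i => ?_
  rw [← hc i]
  simp only [map_sum, map_smul, Finset.sum_apply, Pi.smul_apply, smul_eq_mul,
    rescaledAmplitude_coherent]
  refine Finset.sum_congr rfl fun j _ => ?_
  rw [mul_assoc, inv_mul_cancel_left₀ (Complex.exp_ne_zero _)]

-- A repeated root of the characteristic polynomial is split into nearby distinct roots while the
-- initial values are kept; distinct roots are the amplitudes of a superposition.
theorem mem_closure_coherentSuperpositions {k : ℕ} {ψ : FockSpace} {α : Fin k → ℂ}
    (hψ : (recurrenceOfRoots α).IsSolution (rescaledAmplitude ψ)) :
    ψ ∈ closure (coherentSuperpositions k) := by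
  let init : Fin k → ℂ := fun i => rescaledAmplitude ψ i
  have hψ' : rescaledAmplitude ψ = (recurrenceOfRoots α).mkSol init :=
    (recurrenceOfRoots α).eq_mk_of_is_sol_of_eq_init' hψ fun _ => rfl
  choose! χ hχ hχ' using fun (β : Fin k → ℂ) (hβ : Function.Injective β) =>
    exists_rescaledAmplitude_eq_mkSol hβ init
  let l := 𝓝[{β | Function.Injective β}] α
  have : l.NeBot := mem_closure_iff_nhdsWithin_neBot.1 (dense_setOf_injective α)
  have hinj : ∀ᶠ β in l, Function.Injective β := self_mem_nhdsWithin
  have hcoeffs : Tendsto coeffsOfRoots l (𝓝 (coeffsOfRoots α)) :=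
    ((continuous_coeffsOfRoots k).tendsto α).mono_left nhdsWithin_le_nhds
  have hlim : Tendsto (fun β => (recurrenceOfRoots β).mkSol init) l
      (𝓝 ((recurrenceOfRoots α).mkSol init)) :=
    ((continuous_mkSol k).tendsto (coeffsOfRoots α, init)).comp
      (hcoeffs.prodMk_nhds tendsto_const_nhds)
  obtain ⟨M, hM⟩ := exists_eventually_norm_mkSol_le (coeffsOfRoots α)
  refine mem_closure_of_tendsto (f := χ) (b := l)
    (tendsto_of_rescaledAmplitude (B := 2 * ‖init‖) (M := M) ?_ ?_) (hinj.mono hχ)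
  · filter_upwards [hinj, hcoeffs.eventually hM] with β hβ hβM n
    rw [map_sub, Pi.sub_apply, hχ' β hβ, hψ', mul_assoc, two_mul]
    exact (norm_sub_le _ _).trans (add_le_add (hβM init n) (hM.self_of_nhds init n))
  · rw [hψ']
    exact hlim.congr' (hinj.mono fun β hβ => (hχ' β hβ).symm)

theorem closure_coherentSuperpositions (k : ℕ) :
    closure (coherentSuperpositions k) = {ψ | SatisfiesRecurrence (rescaledAmplitude ψ) k} := by
  refine Set.Subset.antisymm (closure_minimal ?_ ?_) ?_
  · rintro _ ⟨c, α, rfl⟩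
    exact ⟨recurrenceOfRoots α, rfl, isSolution_recurrenceOfRoots c α⟩
  · exact (isClosed_setOf_satisfiesRecurrence k).preimage rescaledAmplitude.continuous
  · intro ψ hψ
    obtain ⟨p, hp, rfl, hs⟩ := satisfiesRecurrence_iff_exists_monic.1 hψ
    obtain ⟨α, hα⟩ := exists_eq_prod_X_sub_C hp
    refine mem_closure_coherentSuperpositions (α := α) ?_
    rwa [isSolution_iff_aeval_charPoly, charPoly_recurrenceOfRoots, ← hα]

theorem approxCoherentRank_eq_iff {ψ : FockSpace} (hψ : ‖ψ‖ = 1) {r : ℕ} :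
    approxCoherentRank ψ = r ↔ FollowsRecurrenceOfOrder (rescaledAmplitude ψ) r := by
  have happrox (k : ℕ) :
      ApproximableByCoherent ψ k ↔ SatisfiesRecurrence (rescaledAmplitude ψ) k := by
    rw [approximableByCoherent_iff_mem_closure hψ, closure_coherentSuperpositions]
    rfl
  simp only [approxCoherentRank, happrox]
  exact biInf_natCast_eq_iff

end Superpositions

section LadderOperators

theorem toFock_apply (C : CoreVector) (n : ℕ) : toFock C n = C n := by
  induction C using Finsupp.induction_linear with
  | zero => simp
  | add f g hf hg => simp [hf, hg]
  | single m z =>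
    simp [toFock, fock, Finsupp.single_apply, lp.single_apply, Pi.single_apply, eq_comm]

theorem annihilation_apply (C : CoreVector) (n : ℕ) :
    annihilation C n = ((√(n + 1 : ℝ) : ℝ) : ℂ) * C (n + 1) := by
  induction C using Finsupp.induction_linear with
  | zero => simp
  | add f g hf hg => simp [hf, hg, mul_add]
  | single m z =>
    rcases m with _ | m
    · simp [annihilation]
    · rcases eq_or_ne m n with rfl | h
      · simp [annihilation, mul_comm]
      · simp [annihilation, h]

theorem annihilation_vacuum : annihilation (Finsupp.single 0 1) = 0 := by
  simp [annihilation]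

theorem creation_apply_zero (C : CoreVector) : creation C 0 = 0 := by
  induction C using Finsupp.induction_linear with
  | zero => simp
  | add f g hf hg => simp [hf, hg]
  | single m z => simp [creation]

theorem creation_apply_succ (C : CoreVector) (n : ℕ) :
    creation C (n + 1) = ((√(n + 1 : ℝ) : ℝ) : ℂ) * C n := by
  induction C using Finsupp.induction_linear with
  | zero => simp
  | add f g hf hg => simp [hf, hg, mul_add]
  | single m z =>
    rcases eq_or_ne m n with rfl | h
    · simp [creation, mul_comm]
    · simp [creation, h]

theorem ofReal_sqrt_natCast_add_one_ne_zero (n : ℕ) : ((√(n + 1 : ℝ) : ℝ) : ℂ) ≠ 0 :=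
  Complex.ofReal_ne_zero.2 (Real.sqrt_pos.2 n.cast_add_one_pos).ne'

theorem annihilation_mul_creation : annihilation * creation = creation * annihilation + 1 := by
  refine LinearMap.ext fun C => Finsupp.ext fun n => ?_
  have hsq (m : ℕ) : ((√(m + 1 : ℝ) : ℝ) : ℂ) * ((√(m + 1 : ℝ) : ℝ) : ℂ) = m + 1 := by
    rw [← Complex.ofReal_mul, Real.mul_self_sqrt (by positivity)]
    norm_cast
  rw [Module.End.mul_apply, annihilation_apply, creation_apply_succ, ← mul_assoc, hsq]
  rcases n with _ | n
  · simp [creation_apply_zero]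
  · simp [creation_apply_succ, annihilation_apply, ← mul_assoc, hsq, add_mul]

theorem annihilation_mul_displacementGenerator (α : ℂ) :
    annihilation * displacementGenerator α = displacementGenerator α * annihilation + α • 1 :=
  mul_smul_sub_smul_of_mul_eq_mul_add_one (A := Module.End ℂ CoreVector) annihilation_mul_creation
    α (conj α)

theorem annihilation_mul_displacementGenerator_pow_succ (α : ℂ) (m : ℕ) :
    annihilation * displacementGenerator α ^ (m + 1) =
      displacementGenerator α ^ (m + 1) * annihilation +
        ((m + 1 : ℕ) * α) • displacementGenerator α ^ m :=
  mul_pow_succ_of_mul_eq_mul_add_smul_one (A := Module.End ℂ CoreVector)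
    (annihilation_mul_displacementGenerator α) m

theorem annihilation_pow_apply_eq_zero_iff {n : ℕ} {C : CoreVector} :
    (annihilation ^ n) C = 0 ↔ ∀ m, n ≤ m → C m = 0 := by
  induction n generalizing C with
  | zero => simp [Finsupp.ext_iff]
  | succ n ih =>
    simp only [pow_succ, Module.End.mul_apply, ih, annihilation_apply, mul_eq_zero,
      ofReal_sqrt_natCast_add_one_ne_zero, false_or]
    refine ⟨fun h m hm => ?_, fun h m hm => h _ (by lia)⟩
    obtain ⟨m, rfl⟩ := Nat.exists_eq_add_of_lt hm
    exact h _ (by lia)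

theorem eq_smul_vacuum_of_annihilation_eq_zero {C : CoreVector} (hC : annihilation C = 0) :
    C = C 0 • Finsupp.single 0 1 := by
  have h := annihilation_pow_apply_eq_zero_iff.1 ((pow_one annihilation).symm ▸ hC)
  ext n
  rcases n with _ | n
  · simp
  · simp [h (n + 1) (by lia)]

theorem annihilation_surjective : Function.Surjective annihilation := by
  intro C
  induction C using Finsupp.induction_linear with
  | zero => exact ⟨0, map_zero _⟩
  | add f g hf hg =>
    obtain ⟨C, rfl⟩ := hf
    obtain ⟨D, rfl⟩ := hg
    exact ⟨C + D, map_add _ _ _⟩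
  | single n z =>
    refine ⟨Finsupp.single (n + 1) (z / ((√(n + 1 : ℝ) : ℝ) : ℂ)), ?_⟩
    have := ofReal_sqrt_natCast_add_one_ne_zero n
    simp [annihilation, this]

end LadderOperators

section Displacement

theorem shift_rescaledAmplitude_toFock (C : CoreVector) :
    shift ℂ (rescaledAmplitude (toFock C)) = rescaledAmplitude (toFock (annihilation C)) := by
  ext n
  rw [shift_apply, rescaledAmplitude_apply, rescaledAmplitude_apply, toFock_apply, toFock_apply,
    annihilation_apply, ← mul_assoc, ← Complex.ofReal_mul, ← Real.sqrt_mul (by positivity),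
    Nat.factorial_succ, Nat.cast_mul, Nat.cast_succ, mul_comm (n ! : ℝ)]

/-- The rescaled amplitudes of `D(α)|C⟩`, as a linear function of the core vector `C`. -/
def displacedAmplitude (α : ℂ) : CoreVector →ₗ[ℂ] (ℕ → ℂ) where
  toFun C := rescaledAmplitude (displace α C)
  map_add' C D := by
    rw [← map_add, displace, displace, displace,
      ← (summable_displace α C).tsum_add (summable_displace α D)]
    simp only [map_add, smul_add]
  map_smul' z C := by
    rw [RingHom.id_apply, ← map_smul, displace, displace,
      ← (summable_displace α C).tsum_const_smul]
    simp only [map_smul, smul_comm z]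

theorem displacedAmplitude_apply (α : ℂ) (C : CoreVector) :
    displacedAmplitude α C = rescaledAmplitude (displace α C) := rfl

theorem hasSum_displacedAmplitude (α : ℂ) (C : CoreVector) :
    HasSum (fun m : ℕ => (m ! : ℂ)⁻¹ •
      rescaledAmplitude (toFock ((displacementGenerator α ^ m) C))) (displacedAmplitude α C) := by
  have h := (summable_displace α C).hasSum.mapL rescaledAmplitude
  simp only [map_smul] at h
  exact h

-- The commutator `[a, αa† - α*a] = α` gives `a D(α) = D(α) (a + α)`, and `a` acts on rescaled
-- amplitudes as the shift.
theorem shift_displacedAmplitude (α : ℂ) (C : CoreVector) :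
    shift ℂ (displacedAmplitude α C) =
      displacedAmplitude α (annihilation C) + α • displacedAmplitude α C := by
  set T : CoreVector → ℕ → ℕ → ℂ := fun D m =>
    (m ! : ℂ)⁻¹ • rescaledAmplitude (toFock ((displacementGenerator α ^ m) D)) with hT
  have hsum (D : CoreVector) : HasSum (T D) (displacedAmplitude α D) :=
    hasSum_displacedAmplitude α D
  have hshift : HasSum (fun m => shift ℂ (T C m)) (shift ℂ (displacedAmplitude α C)) :=
    (hsum C).map (shift ℂ) (continuous_pi fun n => continuous_apply (n + 1))
  have hzero : shift ℂ (T C 0) = T (annihilation C) 0 := by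
    simp [hT, shift_rescaledAmplitude_toFock]
  have hsucc (m : ℕ) : shift ℂ (T C (m + 1)) = T (annihilation C) (m + 1) + α • T C m := by
    have hm : ((m + 1)! : ℂ)⁻¹ * ((m + 1 : ℕ) * α) = α * (m ! : ℂ)⁻¹ := by
      have : (m + 1 : ℂ) ≠ 0 := Nat.cast_add_one_ne_zero m
      rw [Nat.factorial_succ]
      push_cast
      field_simp
    simp only [hT, map_smul, shift_rescaledAmplitude_toFock]
    rw [← Module.End.mul_apply, annihilation_mul_displacementGenerator_pow_succ,
      LinearMap.add_apply, LinearMap.smul_apply, Module.End.mul_apply, map_add, map_add, map_smul,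
      map_smul, smul_add, smul_smul, smul_smul, hm]
  have hsum' : HasSum (fun m => shift ℂ (T C (m + 1)))
      (displacedAmplitude α (annihilation C) - T (annihilation C) 0 +
        α • displacedAmplitude α C) := by
    simp only [hsucc]
    have h := ((hasSum_nat_add_iff' 1).2 (hsum (annihilation C))).add ((hsum C).const_smul α)
    simpa only [Finset.sum_range_one] using h
  have h := ((hasSum_nat_add_iff' 1).2 hshift).unique hsum'
  rw [Finset.sum_range_one, hzero, sub_add_eq_add_sub] at h
  exact sub_left_injective h

theorem aeval_X_sub_C_apply_displacedAmplitude (α : ℂ) (C : CoreVector) :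
    aeval (shift ℂ) (X - Polynomial.C α) (displacedAmplitude α C) =
      displacedAmplitude α (annihilation C) := by
  simp [shift_displacedAmplitude, Module.algebraMap_end_apply]

theorem displacementGenerator_apply_zero (α : ℂ) (C : CoreVector) :
    displacementGenerator α C 0 = -conj α * annihilation C 0 := by
  simp [displacementGenerator, creation_apply_zero]

theorem displacementGenerator_pow_vacuum_apply_zero (α : ℂ) (m : ℕ) :
    (displacementGenerator α ^ (m + 2)) (Finsupp.single 0 1) 0 =
      -(‖α‖ ^ 2 : ℝ) * (m + 1) * (displacementGenerator α ^ m) (Finsupp.single 0 1) 0 := by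
  rw [pow_succ', Module.End.mul_apply, displacementGenerator_apply_zero, ← Module.End.mul_apply,
    annihilation_mul_displacementGenerator_pow_succ, LinearMap.add_apply, Module.End.mul_apply,
    annihilation_vacuum, LinearMap.map_zero, zero_add, LinearMap.smul_apply,
    Finsupp.smul_apply, smul_eq_mul, ← Complex.normSq_eq_norm_sq, Complex.normSq_eq_conj_mul_self]
  push_cast
  ring

theorem displacedAmplitude_vacuum_apply_zero (α : ℂ) :
    displacedAmplitude α (Finsupp.single 0 1) 0 = Complex.exp (-((‖α‖ ^ 2 / 2 : ℝ) : ℂ)) := by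
  have hsum := hasSum_div_factorial_of_recurrence
    (b := fun m => (displacementGenerator α ^ m) (Finsupp.single 0 1) 0) (by simp)
    (by simp [displacementGenerator_apply_zero, annihilation_vacuum])
    (displacementGenerator_pow_vacuum_apply_zero α)
  have h := (Pi.hasSum.1 (hasSum_displacedAmplitude α (Finsupp.single 0 1)) 0).unique
    (hsum.congr_fun fun m => by simp [rescaledAmplitude_apply, toFock_apply, div_eq_inv_mul])
  rw [h]
  push_cast
  ring_nf

theorem displace_vacuum (α : ℂ) : displace α (Finsupp.single 0 1) = coherent α := by
  refine rescaledAmplitude_injective (eq_of_shift_eq_smul (μ := α) ?_ ?_ ?_)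
  · have h := shift_displacedAmplitude α (Finsupp.single 0 1)
    rwa [annihilation_vacuum, map_zero, zero_add] at h
  · exact shift_rescaledAmplitude_coherent α
  · rw [rescaledAmplitude_coherent, pow_zero, mul_one]
    exact displacedAmplitude_vacuum_apply_zero α

theorem displacedAmplitude_vacuum (α : ℂ) :
    displacedAmplitude α (Finsupp.single 0 1) = rescaledAmplitude (coherent α) :=
  congrArg rescaledAmplitude (displace_vacuum α)

theorem aeval_X_sub_C_pow_displacedAmplitude (α : ℂ) (m : ℕ) (C : CoreVector) :
    aeval (shift ℂ) ((X - Polynomial.C α) ^ m) (displacedAmplitude α C) =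
      displacedAmplitude α ((annihilation ^ m) C) := by
  rw [map_pow]
  exact pow_apply_of_intertwines (aeval_X_sub_C_apply_displacedAmplitude α) m C

theorem displacedAmplitude_injective (α : ℂ) : Function.Injective (displacedAmplitude α) := by
  refine injective_of_intertwines (aeval_X_sub_C_apply_displacedAmplitude α) (fun C => ?_)
    fun C hC h => ?_
  · obtain ⟨n, hn⟩ := C.support.exists_nat_subset_range
    refine ⟨n, annihilation_pow_apply_eq_zero_iff.2 fun m hm => ?_⟩
    exact Finsupp.notMem_support_iff.1 fun h => (Finset.mem_range.1 (hn h)).not_ge hm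
  · rw [eq_smul_vacuum_of_annihilation_eq_zero hC, map_smul, displacedAmplitude_vacuum] at h
    have h0 : C 0 = 0 := by simpa [rescaledAmplitude_coherent] using congrFun h 0
    rw [eq_smul_vacuum_of_annihilation_eq_zero hC, h0, zero_smul]

theorem exists_displacedAmplitude_eq {α : ℂ} {m : ℕ} {s : ℕ → ℂ}
    (hs : aeval (shift ℂ) ((X - C α) ^ m) s = 0) : ∃ D, displacedAmplitude α D = s := by
  rw [map_pow] at hs
  refine ker_pow_le_range_of_intertwines (aeval_X_sub_C_apply_displacedAmplitude α)
    annihilation_surjective (fun t ht => ?_) m hs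
  have ht' : shift ℂ t = α • t := by
    simpa [sub_eq_zero, Module.algebraMap_end_apply] using ht
  let z := Complex.exp (-((‖α‖ ^ 2 / 2 : ℝ) : ℂ))
  refine ⟨(t 0 / z) • Finsupp.single 0 1, ?_⟩
  rw [map_smul, displacedAmplitude_vacuum]
  refine eq_of_shift_eq_smul (μ := α) ?_ ht' ?_
  · rw [map_smul, shift_rescaledAmplitude_coherent, smul_comm]
  · rw [Pi.smul_apply, rescaledAmplitude_coherent, pow_zero, mul_one, smul_eq_mul]
    exact div_mul_cancel₀ _ (Complex.exp_ne_zero _)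

theorem aeval_X_sub_C_pow_displacedAmplitude_eq_zero_iff {α : ℂ} {m : ℕ} {D : CoreVector} :
    aeval (shift ℂ) ((X - C α) ^ m) (displacedAmplitude α D) = 0 ↔ ∀ i, m ≤ i → D i = 0 := by
  rw [aeval_X_sub_C_pow_displacedAmplitude, map_eq_zero_iff _ (displacedAmplitude_injective α),
    annihilation_pow_apply_eq_zero_iff]

end Displacement

section CoreStates

theorem exists_smul_isCoreState_iff {D : CoreVector} {n : ℕ} :
    (∃ c : ℂ, c ≠ 0 ∧ ∃ C, IsCoreState C n ∧ c • C = D) ↔ D n ≠ 0 ∧ ∀ m, n < m → D m = 0 := by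
  constructor
  · rintro ⟨c, hc, C, ⟨-, hn, hm⟩, rfl⟩
    exact ⟨mul_ne_zero hc hn, fun m h => by rw [Finsupp.smul_apply, hm m h, smul_zero]⟩
  · rintro ⟨hn, hm⟩
    have hD : ‖toFock D‖ ≠ 0 := norm_ne_zero_iff.2 fun h =>
      hn (by rw [← toFock_apply, h, lp.coeFn_zero, Pi.zero_apply])
    have hc : (‖toFock D‖ : ℂ) ≠ 0 := Complex.ofReal_ne_zero.2 hD
    refine ⟨‖toFock D‖, hc, (‖toFock D‖ : ℂ)⁻¹ • D, ⟨?_, ?_, fun m h => ?_⟩, ?_⟩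
    · rw [map_smul, norm_smul, norm_inv, Complex.norm_real, norm_norm, inv_mul_cancel₀ hD]
    · exact mul_ne_zero (inv_ne_zero hc) hn
    · rw [Finsupp.smul_apply, hm m h, smul_zero]
    · rw [smul_inv_smul₀ hc]

theorem aeval_X_sub_C_pow_eq_zero_and_ne_zero_iff {α : ℂ} {n : ℕ} {s : ℕ → ℂ} :
    aeval (shift ℂ) ((X - C α) ^ (n + 1)) s = 0 ∧ aeval (shift ℂ) ((X - C α) ^ n) s ≠ 0 ↔
      ∃ c : ℂ, c ≠ 0 ∧ ∃ C, IsCoreState C n ∧ c • displacedAmplitude α C = s := by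
  have hcore (D : CoreVector) :
      aeval (shift ℂ) ((X - C α) ^ (n + 1)) (displacedAmplitude α D) = 0 ∧
        aeval (shift ℂ) ((X - C α) ^ n) (displacedAmplitude α D) ≠ 0 ↔
          D n ≠ 0 ∧ ∀ i, n < i → D i = 0 := by
    rw [ne_eq, aeval_X_sub_C_pow_displacedAmplitude_eq_zero_iff,
      aeval_X_sub_C_pow_displacedAmplitude_eq_zero_iff]
    refine ⟨fun ⟨h, h'⟩ => ⟨fun hn => h' fun i hi => ?_, h⟩, fun ⟨hn, h⟩ => ⟨h, fun h' => hn ?_⟩⟩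
    · exact hi.eq_or_lt.elim (fun hi => hi ▸ hn) (h i)
    · exact h' n le_rfl
  constructor
  · intro hs
    obtain ⟨D, rfl⟩ := exists_displacedAmplitude_eq hs.1
    obtain ⟨c, hc, C, hC, rfl⟩ := exists_smul_isCoreState_iff.2 ((hcore D).1 hs)
    exact ⟨c, hc, C, hC, ((displacedAmplitude α).map_smul c C).symm⟩
  · rintro ⟨c, hc, D, hD, rfl⟩
    rw [← map_smul, hcore]
    exact exists_smul_isCoreState_iff.1 ⟨c, hc, D, hD, rfl⟩

theorem isDisplacedCoreSuperposition_iff {ψ : FockSpace} {r : ℕ} :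
    IsDisplacedCoreSuperposition ψ r ↔
      ∃ (k : ℕ) (α : Fin k → ℂ) (n : Fin k → ℕ), Function.Injective α ∧ ∑ j, (n j + 1) = r ∧
        ∃ y : Fin k → ℕ → ℂ, rescaledAmplitude ψ = ∑ j, y j ∧
          ∀ j, aeval (shift ℂ) ((X - C (α j)) ^ (n j + 1)) (y j) = 0 ∧
            aeval (shift ℂ) ((X - C (α j)) ^ n j) (y j) ≠ 0 := by
  simp only [aeval_X_sub_C_pow_eq_zero_and_ne_zero_iff]
  constructor
  · rintro ⟨k, c, α, C, n, hc, hα, hC, hr, rfl⟩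
    exact ⟨k, α, n, hα, hr, _, by simp only [map_sum, map_smul, displacedAmplitude_apply],
      fun j => ⟨c j, hc j, C j, hC j, rfl⟩⟩
  · rintro ⟨k, α, n, hα, hr, y, hψ, hy⟩
    choose c hc C hC hy using hy
    refine ⟨k, c, α, C, n, hc, hα, hC, hr, rescaledAmplitude_injective ?_⟩
    simp only [hψ, map_sum, map_smul, ← displacedAmplitude_apply, hy]

theorem followsRecurrenceOfOrder_iff_isDisplacedCoreSuperposition {ψ : FockSpace} {r : ℕ} :
    FollowsRecurrenceOfOrder (rescaledAmplitude ψ) r ↔ IsDisplacedCoreSuperposition ψ r :=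
  isLeast_satisfiesRecurrence_iff_exists_sum.trans isDisplacedCoreSuperposition_iff.symm

end CoreStates

end

end Bosonic

theorem theorem2 (ψ : Bosonic.FockSpace) (hψ : ‖ψ‖ = 1) (r : ℕ) (hr : 0 < r) :
    (Bosonic.approxCoherentRank ψ = (r : ℕ∞) ↔
      Bosonic.FollowsRecurrenceOfOrder
        (fun n : ℕ => ((√(n ! : ℝ) : ℝ) : ℂ) * ψ n) r) ∧
    (Bosonic.approxCoherentRank ψ = (r : ℕ∞) ↔
      Bosonic.IsDisplacedCoreSuperposition ψ r) :=
  ⟨Bosonic.approxCoherentRank_eq_iff hψ, (Bosonic.approxCoherentRank_eq_iff hψ).trans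
    Bosonic.followsRecurrenceOfOrder_iff_isDisplacedCoreSuperposition⟩
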